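/- Let $V=\{1,\dots,p\}$ and let $F:2^V\to\mathbb{R}$ be a submodular function with $F(\varnothing)=F(V)=0$. Let $f(w)=\int_{\mathbb{R}}F(\{k\in V: w_k\ge\alpha\})\,d\alpha$ be its Lovász extension on $\mathbb{R}^p$ and let $\lambda\ge 0$. A lattice $\mathcal{D}\subset 2^V$ is a family of sets containing $\varnothing$ and $V$ and stable under union and intersection. Its poset $\Pi(\mathcal{D})=\{A_1,\dots,A_m\}$ consists of the differences between consecutive sets of the maximal chains of $\mathcal{D}$; these sets form a partition of $V$, ordered so that $A_i$ is below $A_j$ if every set of $\mathcal{D}$ containing $A_j$ contains $A_i$. Consider the lattices $\mathcal{D}$ such that (i) $F(A)+F(B)=F(A\cup B)+F(A\cap B)$ for all $A,B\in\mathcal{D}$; (ii) for every $j$, with $B$ the union of the elements of $\Pi(\mathcal{D})$ strictly below $A_j$, the set $A_j$ is inseparable for $G(C)=F(B\cup C)-F(B)$, i.e. there is no partition of $A_j$ into two nonempty sets $C,C'$ with $G(A_j)=G(C)+G(C')$; (iii) $\mathcal{D}$ is maximal for inclusion among the lattices with the same unordered partition that satisfy (i) and (ii). For every $z\in\mathbb{R}^p$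 the problem $\min_{w\in\mathbb{R}^p}\frac12\|w-z\|_2^2+\lambda f(w)$ has a unique minimizer. If $z$ is a random vector in $\mathbb{R}^p$ whose law is absolutely continuous with respect to the Lebesgue measure, then, with probability one, the unique minimizer $\hat w$ satisfies the following: there is a lattice $\mathcal{D}$ satisfying (i), (ii) and (iii) such that $\hat w$ is constant on each $A_j\in\Pi(\mathcal{D})$, with value $v_j$, such that $v_i>v_j$ whenever $A_i$ is strictly below $A_j$, and such that the (nonempty) constant sets $\{k\in V:\hat w_k=\alpha\}$ of $\hat w$ are exactly the elements of $\Pi(\mathcal{D})$. -/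

import Mathlib

open MeasureTheory

namespace LovaszProx

variable {p : ℕ}

/-- `F` is submodular on the power set of `V = Fin p`. -/
def Submodular (F : Finset (Fin p) → ℝ) : Prop :=
  ∀ A B, F (A ∪ B) + F (A ∩ B) ≤ F A + F B

/-- The level set `{w ≥ α}`. -/
noncomputable def levelSet (w : EuclideanSpace ℝ (Fin p)) (α : ℝ) : Finset (Fin p) :=
  Finset.univ.filter fun k => α ≤ w k

/-- The Lovász extension `f(w) = ∫ F({w ≥ α}) dα` of a set function with
`F(∅) = F(V) = 0` (the integrand is then a step function with bounded support). -/
noncomputable def lovasz (F : Finset (Fin p) → ℝ) (w : EuclideanSpace ℝ (Fin p)) : ℝ :=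
  ∫ α : ℝ, F (levelSet w α)

/-- The proximal objective `½ ‖w - z‖₂² + t f(w)` with regularization parameter `t`. -/
noncomputable def proxObjective (F : Finset (Fin p) → ℝ) (t : ℝ)
    (z w : EuclideanSpace ℝ (Fin p)) : ℝ :=
  1 / 2 * ‖w - z‖ ^ 2 + t * lovasz F w

/-- The (nonempty) constant sets `{w = α}` of `w`. -/
def constantSets (w : EuclideanSpace ℝ (Fin p)) : Set (Finset (Fin p)) :=
  {S | S.Nonempty ∧ ∃ α : ℝ, ∀ k, k ∈ S ↔ w k = α}

/-- A lattice of subsets of `V`: stable under union and intersection, containing `∅` and `V`. -/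
structure IsSetLattice (D : Set (Finset (Fin p))) : Prop where
  empty_mem : ∅ ∈ D
  univ_mem : Finset.univ ∈ D
  union_mem : ∀ A ∈ D, ∀ B ∈ D, A ∪ B ∈ D
  inter_mem : ∀ A ∈ D, ∀ B ∈ D, A ∩ B ∈ D

/-- `A` and `B` are consecutive in (some maximal chain of) `D`. -/
def Consecutive (D : Set (Finset (Fin p))) (A B : Finset (Fin p)) : Prop :=
  A ∈ D ∧ B ∈ D ∧ A ⊂ B ∧ ∀ C ∈ D, A ⊆ C → C ⊆ B → C = A ∨ C = B

/-- The elements of the poset `Π(D)`: the differences of consecutive sets of the maximal chains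
of `D`. -/
def blocks (D : Set (Finset (Fin p))) : Set (Finset (Fin p)) :=
  {S | ∃ A B, Consecutive D A B ∧ S = B \ A}

/-- The order of `Π(D)`, under which the sets of `D` are the unions of the ideals (lower sets) of
`Π(D)`: `A'` is lower than or equal to `A` when each set of `D` that contains `A` contains
`A'`. -/
def Below (D : Set (Finset (Fin p))) (A' A : Finset (Fin p)) : Prop :=
  ∀ X ∈ D, A ⊆ X → A' ⊆ X

/-- The union of the elements of `Π(D)` strictly below `A` (the ancestors of `A`). -/
noncomputable def ancestors (D : Set (Finset (Fin p))) (A : Finset (Fin p)) : Finset (Fin p) :=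
  open scoped Classical in
  Finset.univ.filter fun k => ∃ A' ∈ blocks D, A' ≠ A ∧ Below D A' A ∧ k ∈ A'

/-- `A` is separable for `G` if `G(A) = G(B) + G(C)` for a nontrivial partition `A = B ∪ C`;
inseparable otherwise. -/
def Inseparable (G : Finset (Fin p) → ℝ) (A : Finset (Fin p)) : Prop :=
  ¬ ∃ B C : Finset (Fin p), B.Nonempty ∧ C.Nonempty ∧ Disjoint B C ∧ B ∪ C = A ∧
    G A = G B + G C

/-- The restriction of `F` to `D` is modular. -/
def ModularOn (F : Finset (Fin p) → ℝ) (D : Set (Finset (Fin p))) : Prop :=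
  ∀ A ∈ D, ∀ B ∈ D, F A + F B = F (A ∪ B) + F (A ∩ B)

/-- Each element `A` of `Π(D)`, with `B` the union of its ancestors, is inseparable for
`C ↦ F(B ∪ C) - F(B)`. -/
def BlocksInseparable (F : Finset (Fin p) → ℝ) (D : Set (Finset (Fin p))) : Prop :=
  ∀ A ∈ blocks D, Inseparable (fun C => F (ancestors D A ∪ C) - F (ancestors D A)) A

/-- The lattices that characterize the faces of the unit ball `{f ≤ 1}`: `D` satisfies the
modularity and the inseparability conditions and is maximal, for inclusion, among the lattices
with the same unordered partition that satisfy both. -/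
def IsFaceLattice (F : Finset (Fin p) → ℝ) (D : Set (Finset (Fin p))) : Prop :=
  Maximal (fun D' => IsSetLattice D' ∧ blocks D' = blocks D ∧ ModularOn F D' ∧
    BlocksInseparable F D') D

/-- The cone attached to `D`: the vectors which are constant on each element of `Π(D)` and whose
value on an element is strictly smaller than on each element strictly below it (so that the
level sets `{w ≥ α}` belong to `D`). -/
def openFaceCone (D : Set (Finset (Fin p))) : Set (EuclideanSpace ℝ (Fin p)) :=
  {w | (∀ A ∈ blocks D, ∀ k ∈ A, ∀ l ∈ A, w k = w l) ∧
    ∀ A' ∈ blocks D, ∀ A ∈ blocks D, A' ≠ A → Below D A' A → ∀ k ∈ A', ∀ l ∈ A, w l < w k}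

/-- The elements of `Π(D)` are the classes of indices that no set of `D` separates. -/
theorem mem_blocks_iff {D : Set (Finset (Fin p))} (hD : IsSetLattice D) (S : Finset (Fin p)) :
    S ∈ blocks D ↔ ∃ k, ∀ l, l ∈ S ↔ ∀ X ∈ D, (k ∈ X ↔ l ∈ X) := by
  classical
  constructor
  · rintro ⟨A, B, ⟨hA, hB, hAB, hmax⟩, rfl⟩
    obtain ⟨k, hkB, hkA⟩ := Finset.exists_of_ssubset hAB
    have key : ∀ l, l ∈ B → l ∉ A → ∀ X ∈ D, l ∈ X → B ⊆ A ∪ X := by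
      intro l hlB hlA X hX hlX
      have hC : A ∪ (X ∩ B) ∈ D := hD.union_mem _ hA _ (hD.inter_mem _ hX _ hB)
      rcases hmax _ hC Finset.subset_union_left
        (Finset.union_subset hAB.subset Finset.inter_subset_right) with h | h
      · exact absurd (h ▸ (by simp [hlX, hlB] : l ∈ A ∪ (X ∩ B))) hlA
      · intro m hm
        rw [← h] at hm
        simp only [Finset.mem_union, Finset.mem_inter] at hm ⊢
        tauto
    refine ⟨k, fun l => ⟨fun hl X hX => ?_, fun h => ?_⟩⟩
    · obtain ⟨hlB, hlA⟩ := Finset.mem_sdiff.1 hl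
      constructor
      · intro hkX
        have := key k hkB hkA X hX hkX hlB
        simp only [Finset.mem_union] at this
        tauto
      · intro hlX
        have := key l hlB hlA X hX hlX hkB
        simp only [Finset.mem_union] at this
        tauto
    · exact Finset.mem_sdiff.2 ⟨(h B hB).1 hkB, fun hl => hkA ((h A hA).2 hl)⟩
  · rintro ⟨k, hk⟩
    -- `B` is the smallest set of `D` that contains `k`, `A` the largest one in `B` without `k`
    obtain ⟨B, ⟨hB, hkB⟩, hBmin⟩ := (Set.toFinite {X | X ∈ D ∧ k ∈ X}).exists_minimal
      ⟨Finset.univ, hD.univ_mem, Finset.mem_univ k⟩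
    obtain ⟨A, ⟨hA, hkA, hAB⟩, hAmax⟩ := (Set.toFinite {X | X ∈ D ∧ k ∉ X ∧ X ⊆ B}).exists_maximal
      ⟨∅, hD.empty_mem, by simp, by simp⟩
    have hBle : ∀ X ∈ D, k ∈ X → B ⊆ X := fun X hX hkX =>
      (hBmin ⟨hD.inter_mem _ hB _ hX, by simp [hkB, hkX]⟩ Finset.inter_subset_left).trans
        Finset.inter_subset_right
    have hAge : ∀ X ∈ D, k ∉ X → X ⊆ B → X ⊆ A := fun X hX hkX hXB =>
      Finset.subset_union_right.trans
        (hAmax ⟨hD.union_mem _ hA _ hX, by simp [hkA, hkX], Finset.union_subset hAB hXB⟩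
          Finset.subset_union_left)
    refine ⟨A, B, ⟨hA, hB, ⟨hAB, fun h => hkA (h hkB)⟩, fun C hC hAC hCB => ?_⟩, ?_⟩
    · by_cases hkC : k ∈ C
      · exact Or.inr (hCB.antisymm (hBle C hC hkC))
      · exact Or.inl ((hAge C hC hkC hCB).antisymm hAC)
    · ext l
      rw [hk, Finset.mem_sdiff]
      refine ⟨fun h => ⟨(h B hB).1 hkB, fun hl => hkA ((h A hA).2 hl)⟩, ?_⟩
      rintro ⟨hlB, hlA⟩ X hX
      refine ⟨fun hkX => hBle X hX hkX hlB, fun hlX => ?_⟩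
      by_contra hkX
      exact hlA (hAge (X ∩ B) (hD.inter_mem _ hX _ hB) (by simp [hkX])
        Finset.inter_subset_right (by simp [hlX, hlB]))

end LovaszProx

/-! The greedy algorithm shows that `f` is the support function of the base polytope of `F`. Hence
`f` is convex, and adding the quadratic term gives existence and uniqueness of the minimizer `w`.

Let `A = {w = α}`, `B = {w > α}` and `G(C) = F(B ∪ C) - F(B)`. Raising `w` on a part `C` of `A`
gives `z(C) - α|C| ≤ t G(C)`; lowering it on `A` gives the reverse inequality for `C = A`. If `G(A)
= G(C) + G(C')` for a partition of `A`, both upper bounds are equalities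
(`mem_hyperplane_of_separable`). Eliminating `α` puts `z` on a hyperplane that depends only on `B`,
`C`, `C'`. There are finitely many such hyperplanes, all null, so almost surely every constant set
is inseparable.

The level sets of `w` then form a chain, on which `F` is trivially modular and whose blocks are the
constant sets. Enlarging this chain to a maximal lattice with the same blocks only removes order
relations, so `w` stays in the open cone (`exists_isFaceLattice`). -/

namespace LovaszProx

variable {p : ℕ}

/-! ### Bases and the greedy algorithm. -/

/-- The base polytope of `F`. -/
def IsBase (F : Finset (Fin p) → ℝ) (s : Fin p → ℝ) : Prop :=
  (∀ A, ∑ k ∈ A, s k ≤ F A) ∧ ∑ k, s k = F Finset.univ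

/-- Edmonds' greedy algorithm: a base that is tight on the level sets of `w`. -/
theorem exists_isBase_tight {F : Finset (Fin p) → ℝ} (hF : Submodular F) (hF0 : F ∅ = 0)
    (w : EuclideanSpace ℝ (Fin p)) :
    ∃ s, IsBase F s ∧ ∀ α, ∑ k ∈ levelSet w α, s k = F (levelSet w α) := by
  suffices h : ∀ S : Finset (Fin p), ∃ s : Fin p → ℝ, (∀ A ⊆ S, ∑ k ∈ A, s k ≤ F A) ∧
      (∑ k ∈ S, s k = F S) ∧
      ∀ α, ∑ k ∈ S.filter (fun k => α ≤ w k), s k = F (S.filter fun k => α ≤ w k) by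
    obtain ⟨s, h1, h2, h3⟩ := h Finset.univ
    exact ⟨s, ⟨fun A => h1 A (Finset.subset_univ A), h2⟩, h3⟩
  intro S
  -- Indices enter by decreasing `w`, so a level set of `insert a S` is either the whole set or a
  -- level set of `S`.
  induction S using Finset.induction_on_min_value (fun k => w k) with
  | empty => exact ⟨0, by simp [hF0, Finset.subset_empty], by simp [hF0], by simp [hF0]⟩
  | insert a S ha hmin ih =>
    obtain ⟨s, h1, h2, h3⟩ := ih
    set s' := Function.update s a (F (insert a S) - F S) with hs'
    have hsum : ∀ A, a ∉ A → ∑ k ∈ A, s' k = ∑ k ∈ A, s k := fun A hA =>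
      Finset.sum_congr rfl fun k hk => by
        rw [hs', Function.update_of_ne (ne_of_mem_of_not_mem hk hA)]
    have hsa : s' a = F (insert a S) - F S := by simp [hs']
    have htot : ∑ k ∈ insert a S, s' k = F (insert a S) := by
      rw [Finset.sum_insert ha, hsum S ha, h2, hsa]; ring
    refine ⟨s', fun A hA => ?_, htot, fun α => ?_⟩
    · by_cases haA : a ∈ A
      · have hsub : A.erase a ⊆ S := Finset.subset_insert_iff.1 hA
        have hu : A ∪ S = insert a S := by
          ext k; have := @hA k; simp only [Finset.mem_union, Finset.mem_insert] at *
          constructor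
          · rintro (h | h); exacts [this h, Or.inr h]
          · rintro (rfl | h); exacts [Or.inl haA, Or.inr h]
        have hi : A ∩ S = A.erase a := by
          ext k; have := @hsub k; simp only [Finset.mem_inter, Finset.mem_erase] at *
          exact ⟨fun h => ⟨fun e => ha (e ▸ h.2), h.1⟩, fun h => ⟨h.2, this h⟩⟩
        -- Diminishing returns: `F (insert a S) - F S ≤ F A - F (A.erase a)`.
        have := hF A S
        rw [hu, hi] at this
        rw [← Finset.add_sum_erase A s' haA, hsum _ (Finset.notMem_erase a A), hsa]
        linarith [h1 _ hsub]
      · rw [hsum A haA]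
        exact h1 A ((Finset.subset_insert_iff_of_notMem haA).1 hA)
    · by_cases hα : α ≤ w a
      · rw [Finset.filter_true_of_mem, htot]
        intro k hk
        rcases Finset.mem_insert.1 hk with rfl | hk
        exacts [hα, hα.trans (hmin k hk)]
      · rw [Finset.filter_insert, if_neg hα, hsum _ (by simp [hα]), h3]

/-! ### The Lovász extension as a support function. -/

/-- The difference of the indicator functions of `(-∞, a]` and `(-∞, 0]`. -/
noncomputable def layer (a β : ℝ) : ℝ := (if β ≤ a then 1 else 0) - if β ≤ 0 then 1 else 0

theorem layer_eq (a : ℝ) :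
    layer a = fun β => (Set.Ioc 0 a).indicator (fun _ => (1 : ℝ)) β -
      (Set.Ioc a 0).indicator (fun _ => (1 : ℝ)) β := by
  funext β
  simp only [layer, Set.indicator_apply, Set.mem_Ioc]
  grind

theorem integrable_indicator_Ioc (a b c : ℝ) :
    Integrable ((Set.Ioc a b).indicator fun _ => c) :=
  (integrable_indicator_iff measurableSet_Ioc).2 (integrableOn_const (by simp))

theorem integral_indicator_Ioc (a b c : ℝ) :
    ∫ x, (Set.Ioc a b).indicator (fun _ => c) x = max (b - a) 0 * c := by
  rw [integral_indicator measurableSet_Ioc, setIntegral_const, smul_eq_mul]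
  simp [Measure.real, ENNReal.toReal_ofReal']

theorem integrable_layer (a : ℝ) : Integrable (layer a) := by
  rw [layer_eq]
  exact (integrable_indicator_Ioc _ _ _).sub (integrable_indicator_Ioc _ _ _)

theorem integral_layer (a : ℝ) : ∫ β, layer a β = a := by
  rw [layer_eq, integral_sub (integrable_indicator_Ioc _ _ _) (integrable_indicator_Ioc _ _ _),
    integral_indicator_Ioc, integral_indicator_Ioc]
  rcases le_total a 0 with h | h <;> simp [h]

/-- Subtracting the indicator of `(-∞, 0]` costs nothing because `s` has total zero, and it makes
each summand integrable on its own. -/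
theorem sum_levelSet_eq {s : Fin p → ℝ} (hs : ∑ k, s k = 0) (w : EuclideanSpace ℝ (Fin p))
    (β : ℝ) : ∑ k ∈ levelSet w β, s k = ∑ k, s k * layer (w k) β := by
  simp only [layer, mul_sub, Finset.sum_sub_distrib]
  rw [← Finset.sum_mul, hs, zero_mul, sub_zero]
  simp only [levelSet, Finset.sum_filter, mul_ite, mul_one, mul_zero]

theorem integrable_sum_levelSet {s : Fin p → ℝ} (hs : ∑ k, s k = 0)
    (w : EuclideanSpace ℝ (Fin p)) : Integrable fun β => ∑ k ∈ levelSet w β, s k := by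
  simp only [sum_levelSet_eq hs]
  exact integrable_finsetSum _ fun k _ => (integrable_layer _).const_mul _

theorem integral_sum_levelSet {s : Fin p → ℝ} (hs : ∑ k, s k = 0)
    (w : EuclideanSpace ℝ (Fin p)) : ∫ β, ∑ k ∈ levelSet w β, s k = ∑ k, s k * w k := by
  simp only [sum_levelSet_eq hs]
  rw [integral_finsetSum _ fun k _ => (integrable_layer _).const_mul _]
  simp only [integral_const_mul, integral_layer]


theorem integrable_levelSet {F : Finset (Fin p) → ℝ} (hF : Submodular F) (hF0 : F ∅ = 0)
    (hF1 : F Finset.univ = 0) (w : EuclideanSpace ℝ (Fin p)) :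
    Integrable fun β => F (levelSet w β) := by
  obtain ⟨s, hs, htight⟩ := exists_isBase_tight hF hF0 w
  simpa only [htight] using integrable_sum_levelSet (hs.2.trans hF1) w

/-- The Lovász extension dominates the linear form of each base. -/
theorem IsBase.inner_le_lovasz {F : Finset (Fin p) → ℝ} {s : Fin p → ℝ} (hs : IsBase F s)
    (hF : Submodular F) (hF0 : F ∅ = 0) (hF1 : F Finset.univ = 0)
    (w : EuclideanSpace ℝ (Fin p)) : ∑ k, s k * w k ≤ lovasz F w := by
  rw [← integral_sum_levelSet (hs.2.trans hF1)]
  exact integral_mono (integrable_sum_levelSet (hs.2.trans hF1) w)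
    (integrable_levelSet hF hF0 hF1 w) fun β => hs.1 _

theorem exists_isBase_lovasz_eq {F : Finset (Fin p) → ℝ} (hF : Submodular F) (hF0 : F ∅ = 0)
    (hF1 : F Finset.univ = 0) (w : EuclideanSpace ℝ (Fin p)) :
    ∃ s, IsBase F s ∧ lovasz F w = ∑ k, s k * w k := by
  obtain ⟨s, hs, htight⟩ := exists_isBase_tight hF hF0 w
  refine ⟨s, hs, ?_⟩
  rw [← integral_sum_levelSet (hs.2.trans hF1)]
  simp only [htight, lovasz]

/-- A base attaining `f` at the combination bounds `f` from below at both endpoints. -/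
theorem convexOn_lovasz {F : Finset (Fin p) → ℝ} (hF : Submodular F) (hF0 : F ∅ = 0)
    (hF1 : F Finset.univ = 0) : ConvexOn ℝ Set.univ (lovasz F) := by
  refine ⟨convex_univ, fun x _ y _ a b ha hb _ => ?_⟩
  obtain ⟨s, hs, h⟩ := exists_isBase_lovasz_eq hF hF0 hF1 (a • x + b • y)
  rw [h, smul_eq_mul, smul_eq_mul]
  have e : ∑ k, s k * (a • x + b • y) k = a * ∑ k, s k * x k + b * ∑ k, s k * y k := by
    rw [Finset.mul_sum, Finset.mul_sum, ← Finset.sum_add_distrib]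
    refine Finset.sum_congr rfl fun k _ => ?_
    simp only [PiLp.add_apply, PiLp.smul_apply, smul_eq_mul]
    ring
  rw [e]
  gcongr
  exacts [hs.inner_le_lovasz hF hF0 hF1 x, hs.inner_le_lovasz hF hF0 hF1 y]

theorem continuous_lovasz {F : Finset (Fin p) → ℝ} (hF : Submodular F) (hF0 : F ∅ = 0)
    (hF1 : F Finset.univ = 0) : Continuous (lovasz F) := by
  rw [← continuousOn_univ]
  exact (convexOn_lovasz hF hF0 hF1).continuousOn isOpen_univ

/-! ### Existence and uniqueness of the minimizer. -/

theorem exists_isMinOn_proxObjective {F : Finset (Fin p) → ℝ} (hF : Submodular F)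
    (hF0 : F ∅ = 0) (hF1 : F Finset.univ = 0) {t : ℝ} (ht : 0 ≤ t)
    (z : EuclideanSpace ℝ (Fin p)) : ∃ w, IsMinOn (proxObjective F t z) Set.univ w := by
  obtain ⟨s, hs, -⟩ := exists_isBase_tight hF hF0 z
  have hcont : Continuous (proxObjective F t z) := by
    have := continuous_lovasz hF hF0 hF1
    unfold proxObjective
    fun_prop
  let σ : EuclideanSpace ℝ (Fin p) := WithLp.toLp 2 s
  have hσ : ∀ w, inner ℝ σ w = ∑ k, s k * w k := fun w => by
    simp [σ, PiLp.inner_apply, mul_comm]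
  -- Replacing `f` by the linear form of one base and completing the square gives a coercive lower
  -- bound.
  have hbound : ∀ w, 1 / 2 * ‖w - (z - t • σ)‖ ^ 2 + (t * inner ℝ σ z - 1 / 2 * ‖t • σ‖ ^ 2)
      ≤ proxObjective F t z w := fun w => by
    have h1 : w - (z - t • σ) = (w - z) + t • σ := by abel
    have h2 := mul_le_mul_of_nonneg_left (hs.inner_le_lovasz hF hF0 hF1 w) ht
    rw [← hσ] at h2
    rw [h1, norm_add_sq_real, inner_smul_right, inner_sub_left, real_inner_comm σ w,
      real_inner_comm σ z, proxObjective]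
    linarith
  have hlim : Filter.Tendsto (proxObjective F t z)
      (Filter.cocompact (EuclideanSpace ℝ (Fin p))) Filter.atTop := by
    refine Filter.tendsto_atTop_mono hbound (Filter.tendsto_atTop_add_const_right _ _ ?_)
    refine Filter.Tendsto.const_mul_atTop (by norm_num)
      ((Filter.tendsto_pow_atTop two_ne_zero).comp ?_)
    exact tendsto_norm_cocompact_atTop.comp
      (Homeomorph.subRight (z - t • σ)).isClosedEmbedding.tendsto_cocompact
  obtain ⟨w, hw⟩ := hcont.exists_forall_le hlim
  exact ⟨w, fun x _ => hw x⟩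

theorem eq_of_isMinOn_proxObjective {F : Finset (Fin p) → ℝ} (hF : Submodular F)
    (hF0 : F ∅ = 0) (hF1 : F Finset.univ = 0) {t : ℝ} (ht : 0 ≤ t)
    {z x y : EuclideanSpace ℝ (Fin p)} (hx : IsMinOn (proxObjective F t z) Set.univ x)
    (hy : IsMinOn (proxObjective F t z) Set.univ y) : x = y := by
  have hconv := (convexOn_lovasz hF hF0 hF1).2 (Set.mem_univ x) (Set.mem_univ y)
    (by norm_num : (0 : ℝ) ≤ 1 / 2) (by norm_num : (0 : ℝ) ≤ 1 / 2) (by norm_num)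
  set m := (1 / 2 : ℝ) • x + (1 / 2 : ℝ) • y
  have hmz : m - z = (1 / 2 : ℝ) • ((x - z) + (y - z)) := by module
  have hxm := hx (Set.mem_univ m)
  have hym := hy (Set.mem_univ m)
  have hpar := parallelogram_law_with_norm ℝ (x - z) (y - z)
  rw [sub_sub_sub_cancel_right] at hpar
  have hnorm : ‖m - z‖ ^ 2 = 1 / 4 * ‖(x - z) + (y - z)‖ ^ 2 := by
    rw [hmz, norm_smul, mul_pow]; norm_num
  simp only [Set.mem_ofPred_eq, proxObjective, smul_eq_mul] at hxm hym hconv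
  have := mul_le_mul_of_nonneg_left hconv ht
  -- By the parallelogram law, the midpoint would do strictly better if `x ≠ y`.
  have h0 : ‖x - y‖ ^ 2 ≤ 0 := by nlinarith
  have : ‖x - y‖ = 0 := by nlinarith [norm_nonneg (x - y)]
  exact sub_eq_zero.1 (norm_eq_zero.1 this)

/-! ### First-order optimality conditions. -/

/-- The strict level set `{w > α}`. -/
noncomputable def strictLevelSet (w : EuclideanSpace ℝ (Fin p)) (α : ℝ) : Finset (Fin p) :=
  Finset.univ.filter fun k => α < w k

/-- The vector `c • 1_C`. -/
noncomputable def bump (C : Finset (Fin p)) (c : ℝ) : EuclideanSpace ℝ (Fin p) :=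
  WithLp.toLp 2 fun k => if k ∈ C then c else 0

theorem bump_apply (C : Finset (Fin p)) (c : ℝ) (k : Fin p) :
    bump C c k = if k ∈ C then c else 0 := rfl

theorem norm_add_bump_sq (x : EuclideanSpace ℝ (Fin p)) (C : Finset (Fin p)) (c : ℝ) :
    ‖x + bump C c‖ ^ 2 = ‖x‖ ^ 2 + 2 * c * ∑ k ∈ C, x k + c ^ 2 * C.card := by
  have h1 : inner ℝ x (bump C c) = c * ∑ k ∈ C, x k := by
    simp [PiLp.inner_apply, bump_apply, Finset.mul_sum]
  have h2 : ‖bump C c‖ ^ 2 = c ^ 2 * C.card := by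
    simp [EuclideanSpace.real_norm_sq_eq, bump_apply, ite_pow, mul_comm]
  rw [norm_add_sq_real, h1, h2]; ring

/-- Raising `w` by `c` on a part `C` of `{w = α}`, with no value of `w` in `(α, α + c)`, changes
the Lovász extension linearly. -/
theorem lovasz_add_bump {F : Finset (Fin p) → ℝ} (hF : Submodular F) (hF0 : F ∅ = 0)
    (hF1 : F Finset.univ = 0) {w : EuclideanSpace ℝ (Fin p)} {α c : ℝ} (hc : 0 ≤ c)
    {C : Finset (Fin p)} (hC : ∀ k ∈ C, w k = α) (hgap : ∀ k, α < w k → α + c ≤ w k) :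
    lovasz F (w + bump C c) = lovasz F w +
      c * (F (strictLevelSet w α ∪ C) - F (strictLevelSet w α)) := by
  have key : ∀ β, F (levelSet (w + bump C c) β) = F (levelSet w β) +
      (Set.Ioc α (α + c)).indicator
        (fun _ => F (strictLevelSet w α ∪ C) - F (strictLevelSet w α)) β := by
    intro β
    -- Only thresholds in `(α, α + c]` see the move; there, both level sets are independent of `β`.
    by_cases hβ : β ∈ Set.Ioc α (α + c)
    · have h1 : levelSet (w + bump C c) β = strictLevelSet w α ∪ C := by
        ext k
        have := hC k; have := hgap k
        simp only [levelSet, strictLevelSet, Finset.mem_filter, Finset.mem_univ, true_and,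
          Finset.mem_union, PiLp.add_apply, bump_apply]
        grind
      have h2 : levelSet w β = strictLevelSet w α := by
        ext k
        have := hgap k
        simp only [levelSet, strictLevelSet, Finset.mem_filter, Finset.mem_univ, true_and]
        grind
      rw [Set.indicator_of_mem hβ, h1, h2]; ring
    · have h1 : levelSet (w + bump C c) β = levelSet w β := by
        ext k
        have := hC k
        simp only [levelSet, Finset.mem_filter, Finset.mem_univ, true_and, PiLp.add_apply,
          bump_apply]
        grind
      rw [Set.indicator_of_notMem hβ, h1, add_zero]
  unfold lovasz
  simp only [key]
  rw [integral_add (integrable_levelSet hF hF0 hF1 w) (integrable_indicator_Ioc _ _ _),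
    integral_indicator_Ioc]
  simp [hc]

theorem nonneg_of_eventually_mul_add_sq {X Y : ℝ}
    (h : ∀ᶠ c : ℝ in nhdsWithin 0 (Set.Ioi 0), 0 ≤ c * X + c ^ 2 * Y) : 0 ≤ X := by
  have hlim : Filter.Tendsto (fun c : ℝ => X + c * Y) (nhdsWithin 0 (Set.Ioi 0)) (nhds X) := by
    have : Filter.Tendsto (fun c : ℝ => X + c * Y) (nhds 0) (nhds (X + 0 * Y)) :=
      Continuous.tendsto (by fun_prop) 0
    rw [zero_mul, add_zero] at this
    exact this.mono_left nhdsWithin_le_nhds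
  refine ge_of_tendsto hlim ?_
  filter_upwards [h, self_mem_nhdsWithin] with c hc hc0
  have hc0 : 0 < c := hc0
  have : 0 ≤ c * (X + c * Y) := by linarith
  exact nonneg_of_mul_nonneg_right this hc0

theorem eventually_nhdsGT_le {d : ℝ} (hd : 0 < d) :
    ∀ᶠ c : ℝ in nhdsWithin 0 (Set.Ioi 0), c ≤ d :=
  nhdsWithin_le_nhds (Iic_mem_nhds hd)

/-- First-order optimality in the direction of the indicator of a part `C` of `{w = α}`. -/
theorem sum_sub_le_of_isMinOn {F : Finset (Fin p) → ℝ} (hF : Submodular F) (hF0 : F ∅ = 0)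
    (hF1 : F Finset.univ = 0) {t : ℝ} {z w : EuclideanSpace ℝ (Fin p)}
    (hw : IsMinOn (proxObjective F t z) Set.univ w) {α : ℝ} {C : Finset (Fin p)}
    (hC : ∀ k ∈ C, w k = α) :
    ∑ k ∈ C, (z k - α) ≤ t * (F (strictLevelSet w α ∪ C) - F (strictLevelSet w α)) := by
  have hev : ∀ᶠ c : ℝ in nhdsWithin 0 (Set.Ioi 0), ∀ k, α < w k → α + c ≤ w k := by
    refine Filter.eventually_all.2 fun k => ?_
    by_cases hk : α < w k
    · filter_upwards [eventually_nhdsGT_le (sub_pos.2 hk)] with c hc _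
      linarith
    · exact Filter.Eventually.of_forall fun c h => absurd h hk
  rw [← sub_nonneg]
  refine nonneg_of_eventually_mul_add_sq (Y := 1 / 2 * C.card) ?_
  filter_upwards [hev, self_mem_nhdsWithin] with c hgap hc0
  have hmin := hw (Set.mem_univ (w + bump C c))
  have hsum : ∑ k ∈ C, (w - z) k = -∑ k ∈ C, (z k - α) := by
    rw [← Finset.sum_neg_distrib]
    exact Finset.sum_congr rfl fun k hk => by rw [PiLp.sub_apply, hC k hk]; ring
  simp only [Set.mem_ofPred_eq, proxObjective] at hmin
  rw [lovasz_add_bump hF hF0 hF1 (le_of_lt hc0) hC hgap, add_sub_right_comm, norm_add_bump_sq,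
    hsum] at hmin
  linarith

/-- First-order optimality in the direction opposite to the indicator of `{w = α}`. -/
theorem le_sum_sub_of_isMinOn {F : Finset (Fin p) → ℝ} (hF : Submodular F) (hF0 : F ∅ = 0)
    (hF1 : F Finset.univ = 0) {t : ℝ} {z w : EuclideanSpace ℝ (Fin p)}
    (hw : IsMinOn (proxObjective F t z) Set.univ w) {α : ℝ} {A : Finset (Fin p)}
    (hA : ∀ k, k ∈ A ↔ w k = α) :
    t * (F (strictLevelSet w α ∪ A) - F (strictLevelSet w α)) ≤ ∑ k ∈ A, (z k - α) := by
  have hev : ∀ᶠ c : ℝ in nhdsWithin 0 (Set.Ioi 0), ∀ k, w k < α → w k ≤ α - c := by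
    refine Filter.eventually_all.2 fun k => ?_
    by_cases hk : w k < α
    · filter_upwards [eventually_nhdsGT_le (sub_pos.2 hk)] with c hc _
      linarith
    · exact Filter.Eventually.of_forall fun c h => absurd h hk
  rw [← sub_nonneg]
  refine nonneg_of_eventually_mul_add_sq (Y := 1 / 2 * A.card) ?_
  filter_upwards [hev, self_mem_nhdsWithin] with c hgap hc0
  have hc0 : 0 < c := hc0
  have hmin := hw (Set.mem_univ (w + bump A (-c)))
  have hsum : ∑ k ∈ A, (w - z) k = -∑ k ∈ A, (z k - α) := by
    rw [← Finset.sum_neg_distrib]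
    exact Finset.sum_congr rfl fun k hk => by rw [PiLp.sub_apply, (hA k).1 hk]; ring
  -- The formula for upward moves is applied from the lowered vector back to `w`.
  have hback : w + bump A (-c) + bump A c = w := by
    ext k; simp only [PiLp.add_apply, bump_apply]; split_ifs <;> ring
  have hval : ∀ k, (w + bump A (-c)) k = if k ∈ A then α - c else w k := by
    intro k
    simp only [PiLp.add_apply, bump_apply]
    split_ifs with h
    · rw [(hA k).1 h]; ring
    · ring
  have hstrict : strictLevelSet (w + bump A (-c)) (α - c) = strictLevelSet w α := by
    ext k
    have := hA k; have := hgap k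
    simp only [strictLevelSet, Finset.mem_filter, Finset.mem_univ, true_and, hval]
    grind
  have hlov := lovasz_add_bump hF hF0 hF1 (w := w + bump A (-c)) (α := α - c) hc0.le
    (C := A) (fun k hk => by rw [hval, if_pos hk]) (fun k hk => by
      have := hA k; have := hgap k
      rw [hval] at hk ⊢
      grind)
  rw [hback, hstrict] at hlov
  simp only [Set.mem_ofPred_eq, proxObjective] at hmin
  rw [add_sub_right_comm, norm_add_bump_sq, hsum, hlov] at hmin
  linarith

/-! ### Separable constant sets and null hyperplanes. -/

/-- If a constant set of the minimizer is separable into `C` and `C'`, then `z` lies in a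
hyperplane determined by `C`, `C'` and the strict level set. -/
theorem mem_hyperplane_of_separable {F : Finset (Fin p) → ℝ} (hF : Submodular F)
    (hF0 : F ∅ = 0) (hF1 : F Finset.univ = 0) {t : ℝ} {z w : EuclideanSpace ℝ (Fin p)}
    (hw : IsMinOn (proxObjective F t z) Set.univ w) {α : ℝ} {A B C C' : Finset (Fin p)}
    (hA : ∀ k, k ∈ A ↔ w k = α) (hB : B = strictLevelSet w α) (hdisj : Disjoint C C')
    (hunion : C ∪ C' = A)
    (hsep : F (B ∪ A) - F B = (F (B ∪ C) - F B) + (F (B ∪ C') - F B)) :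
    (C'.card : ℝ) * ∑ k ∈ C, z k - C.card * ∑ k ∈ C', z k =
      C'.card * (t * (F (B ∪ C) - F B)) - C.card * (t * (F (B ∪ C') - F B)) := by
  subst hB
  have h1 := sum_sub_le_of_isMinOn hF hF0 hF1 hw (C := C) fun k hk =>
    (hA k).1 (hunion ▸ Finset.mem_union_left _ hk)
  have h2 := sum_sub_le_of_isMinOn hF hF0 hF1 hw (C := C') fun k hk =>
    (hA k).1 (hunion ▸ Finset.mem_union_right _ hk)
  have h3 := le_sum_sub_of_isMinOn hF hF0 hF1 hw hA
  rw [hsep, ← hunion, Finset.sum_union hdisj] at h3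
  have e1 := le_antisymm h1 (by linarith)
  have e2 := le_antisymm h2 (by linarith)
  -- The weights `|C'|` and `|C|` cancel the unknown level `α`.
  rw [← e1, ← e2]
  simp only [Finset.sum_sub_distrib, Finset.sum_const, nsmul_eq_mul]
  ring

theorem volume_hyperplane_eq_zero {C C' : Finset (Fin p)} (hC : C.Nonempty) (hC' : C'.Nonempty)
    (hdisj : Disjoint C C') (c : ℝ) :
    volume {z : EuclideanSpace ℝ (Fin p) |
      (C'.card : ℝ) * ∑ k ∈ C, z k - C.card * ∑ k ∈ C', z k = c} = 0 := by
  let L : EuclideanSpace ℝ (Fin p) →ₗ[ℝ] ℝ :=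
    (C'.card : ℝ) • ∑ k ∈ C, (EuclideanSpace.proj k : EuclideanSpace ℝ (Fin p) →L[ℝ] ℝ).toLinearMap
      - (C.card : ℝ) •
        ∑ k ∈ C', (EuclideanSpace.proj k : EuclideanSpace ℝ (Fin p) →L[ℝ] ℝ).toLinearMap
  have hL : ∀ z, L z = (C'.card : ℝ) * ∑ k ∈ C, z k - C.card * ∑ k ∈ C', z k := fun z => by
    simp [L]
  simp only [← hL]
  rcases Set.eq_empty_or_nonempty {z | L z = c} with h | ⟨z₀, hz₀⟩
  · rw [h, measure_empty]
  have hset : {z | L z = c} = (AffineSubspace.mk' z₀ (LinearMap.ker L) : Set _) := by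
    ext z
    have hz₀ : L z₀ = c := hz₀
    simp [AffineSubspace.mem_mk', sub_eq_zero, hz₀]
  rw [hset]
  refine Measure.addHaar_affineSubspace _ _ fun htop => ?_
  have hker : LinearMap.ker L = ⊤ := by
    rw [← AffineSubspace.direction_mk' z₀ (LinearMap.ker L), htop, AffineSubspace.direction_top]
  -- The form is nonzero: at the indicator of `C` it equals `|C'| |C|`.
  have h0 : L (bump C 1) = 0 := LinearMap.mem_ker.1 (hker ▸ Submodule.mem_top)
  have hz : ∑ k ∈ C', bump C 1 k = 0 := Finset.sum_eq_zero fun k hk => by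
    rw [bump_apply, if_neg (Finset.disjoint_right.1 hdisj hk)]
  have ho : ∑ k ∈ C, bump C 1 k = C.card := by simp [bump_apply]
  rw [hL, hz, ho, mul_zero, sub_zero] at h0
  have := hC.card_pos; have := hC'.card_pos
  have : (0 : ℝ) < C'.card * C.card := by positivity
  linarith

/-! ### The chain of upper sets of `w` and its maximal enlargement. -/

/-- The sets `X` that contain each `l` with `w k ≤ w l` for some `k ∈ X`. -/
def upperSets (w : EuclideanSpace ℝ (Fin p)) : Set (Finset (Fin p)) :=
  {X | ∀ k ∈ X, ∀ l, w k ≤ w l → l ∈ X}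

theorem isSetLattice_upperSets (w : EuclideanSpace ℝ (Fin p)) : IsSetLattice (upperSets w) where
  empty_mem := by simp [upperSets]
  univ_mem := by simp [upperSets]
  union_mem A hA B hB k hk l hl := by
    rcases Finset.mem_union.1 hk with h | h
    exacts [Finset.mem_union_left _ (hA k h l hl), Finset.mem_union_right _ (hB k h l hl)]
  inter_mem A hA B hB k hk l hl :=
    Finset.mem_inter.2 ⟨hA k (Finset.mem_inter.1 hk).1 l hl, hB k (Finset.mem_inter.1 hk).2 l hl⟩

theorem levelSet_mem_upperSets (w : EuclideanSpace ℝ (Fin p)) (α : ℝ) :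
    levelSet w α ∈ upperSets w := fun k hk l hl => by
  simp only [levelSet, Finset.mem_filter, Finset.mem_univ, true_and] at hk ⊢
  exact hk.trans hl

theorem blocks_upperSets (w : EuclideanSpace ℝ (Fin p)) :
    blocks (upperSets w) = constantSets w := by
  have hclass : ∀ k l, (∀ X ∈ upperSets w, (k ∈ X ↔ l ∈ X)) ↔ w l = w k := by
    refine fun k l => ⟨fun h => le_antisymm ?_ ?_, fun h X hX => ⟨fun hk => hX k hk l h.ge,
      fun hl => hX l hl k h.le⟩⟩
    · simpa [levelSet] using (h _ (levelSet_mem_upperSets w (w l))).2 (by simp [levelSet])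
    · simpa [levelSet] using (h _ (levelSet_mem_upperSets w (w k))).1 (by simp [levelSet])
  ext S
  simp only [mem_blocks_iff (isSetLattice_upperSets w), hclass, constantSets, Set.mem_ofPred_eq]
  constructor
  · rintro ⟨k, hk⟩
    exact ⟨⟨k, (hk k).2 rfl⟩, w k, hk⟩
  · rintro ⟨⟨k, hkS⟩, α, hα⟩
    exact ⟨k, fun l => by rw [hα, (hα k).1 hkS]⟩

theorem below_upperSets_iff {w : EuclideanSpace ℝ (Fin p)} {A' A : Finset (Fin p)} {α' α : ℝ}
    (hne' : A'.Nonempty) (hne : A.Nonempty) (hA' : ∀ k, k ∈ A' ↔ w k = α')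
    (hA : ∀ k, k ∈ A ↔ w k = α) : Below (upperSets w) A' A ↔ α ≤ α' := by
  constructor
  · intro h
    obtain ⟨k, hk⟩ := hne'
    have := h _ (levelSet_mem_upperSets w α) (fun l hl => by simp [levelSet, (hA l).1 hl]) hk
    simpa [levelSet, (hA' k).1 hk] using this
  · intro h X hX hAX k hk
    obtain ⟨l, hl⟩ := hne
    exact hX l (hAX hl) k (by rwa [(hA l).1 hl, (hA' k).1 hk])

theorem ancestors_upperSets {w : EuclideanSpace ℝ (Fin p)} {A : Finset (Fin p)} {α : ℝ}
    (hne : A.Nonempty) (hA : ∀ k, k ∈ A ↔ w k = α) :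
    ancestors (upperSets w) A = strictLevelSet w α := by
  classical
  ext k
  simp only [ancestors, strictLevelSet, Finset.mem_filter, Finset.mem_univ, true_and,
    blocks_upperSets]
  constructor
  · rintro ⟨A', ⟨hne', α', hA'⟩, hAA', hbelow, hk⟩
    rw [below_upperSets_iff hne' hne hA' hA] at hbelow
    rw [(hA' k).1 hk]
    refine lt_of_le_of_ne hbelow fun e => hAA' ?_
    ext l; rw [hA, hA', e]
  · intro hk
    have hA' : ∀ l, l ∈ Finset.univ.filter (fun l => w l = w k) ↔ w l = w k := by simp
    have hne' : (Finset.univ.filter fun l => w l = w k).Nonempty := ⟨k, by simp⟩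
    refine ⟨_, ⟨hne', w k, hA'⟩, fun e => ?_, (below_upperSets_iff hne' hne hA' hA).2 hk.le,
      (hA' k).2 rfl⟩
    exact hk.ne' ((hA k).1 (e ▸ (hA' k).2 rfl))

theorem upperSets_total {w : EuclideanSpace ℝ (Fin p)} {A B : Finset (Fin p)}
    (hA : A ∈ upperSets w) (hB : B ∈ upperSets w) : A ⊆ B ∨ B ⊆ A := by
  by_contra! h
  obtain ⟨k, hkA, hkB⟩ := Finset.not_subset.1 h.1
  obtain ⟨l, hlB, hlA⟩ := Finset.not_subset.1 h.2
  rcases le_total (w k) (w l) with hkl | hkl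
  exacts [hlA (hA k hkA l hkl), hkB (hB l hlB k hkl)]

theorem modularOn_upperSets (F : Finset (Fin p) → ℝ) (w : EuclideanSpace ℝ (Fin p)) :
    ModularOn F (upperSets w) := by
  intro A hA B hB
  rcases upperSets_total hA hB with h | h
  · rw [Finset.union_eq_right.2 h, Finset.inter_eq_left.2 h, add_comm]
  · rw [Finset.union_eq_left.2 h, Finset.inter_eq_right.2 h]

/-- When the constant sets of `w` are inseparable, some face lattice has them as blocks and has
`w` in its open cone. -/
theorem exists_isFaceLattice {F : Finset (Fin p) → ℝ} {w : EuclideanSpace ℝ (Fin p)}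
    (h : BlocksInseparable F (upperSets w)) :
    ∃ D, IsFaceLattice F D ∧ w ∈ openFaceCone D ∧ constantSets w = blocks D := by
  obtain ⟨D, hle, hD⟩ := (Set.toFinite {D' : Set (Finset (Fin p)) | IsSetLattice D' ∧
    blocks D' = blocks (upperSets w) ∧ ModularOn F D' ∧ BlocksInseparable F D'}).exists_le_maximal
    ⟨isSetLattice_upperSets w, rfl, modularOn_upperSets F w, h⟩
  have hblocks : blocks D = blocks (upperSets w) := hD.1.2.1
  refine ⟨D, ?_, ⟨fun A hA k hk l hl => ?_, fun A' hA' A hA hAA' hbelow k hk l hl => ?_⟩, ?_⟩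
  · unfold IsFaceLattice
    rw [hblocks]
    exact hD
  · rw [hblocks, blocks_upperSets] at hA
    obtain ⟨-, α, hα⟩ := hA
    rw [(hα k).1 hk, (hα l).1 hl]
  · rw [hblocks, blocks_upperSets] at hA hA'
    obtain ⟨hne, α, hα⟩ := hA
    obtain ⟨hne', α', hα'⟩ := hA'
    -- More sets in the lattice mean more constraints, so order in `D` implies order in the chain.
    have hb : Below (upperSets w) A' A := fun X hX => hbelow X (hle hX)
    rw [below_upperSets_iff hne' hne hα' hα] at hb
    rw [(hα' k).1 hk, (hα l).1 hl]
    refine lt_of_le_of_ne hb fun e => hAA' ?_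
    ext i; rw [hα, hα', e]
  · rw [hblocks, blocks_upperSets]

end LovaszProx

/-! ### Conclusion. -/

open LovaszProx in
theorem proposition6 {p : ℕ} (F : Finset (Fin p) → ℝ) (hF : LovaszProx.Submodular F)
    (hF_empty : F ∅ = 0) (hF_univ : F Finset.univ = 0) (t : ℝ) (ht : 0 ≤ t)
    {Ω : Type*} [MeasurableSpace Ω] (P : MeasureTheory.Measure Ω)
    [MeasureTheory.IsProbabilityMeasure P] (Z : Ω → EuclideanSpace ℝ (Fin p))
    (hZ : MeasureTheory.HasPDF Z P MeasureTheory.volume) :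
    (∀ z, ∃! w, IsMinOn (LovaszProx.proxObjective F t z) Set.univ w) ∧
    ∀ᵐ ω ∂P, ∀ w, IsMinOn (LovaszProx.proxObjective F t (Z ω)) Set.univ w →
      ∃ D : Set (Finset (Fin p)), LovaszProx.IsFaceLattice F D ∧
        w ∈ LovaszProx.openFaceCone D ∧
        LovaszProx.constantSets w = LovaszProx.blocks D := by
  refine ⟨fun z => ?_, ?_⟩
  · obtain ⟨w, hw⟩ := exists_isMinOn_proxObjective hF hF_empty hF_univ ht z
    exact ⟨w, hw, fun y hy => eq_of_isMinOn_proxObjective hF hF_empty hF_univ ht hy hw⟩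
  -- Quantifying over all `B`, `C`, `C'` makes the exceptional null set independent of the
  -- minimizer.
  have hgeneric : ∀ᵐ z : EuclideanSpace ℝ (Fin p), ∀ B C C' : Finset (Fin p), C.Nonempty →
      C'.Nonempty → Disjoint C C' → (C'.card : ℝ) * ∑ k ∈ C, z k - C.card * ∑ k ∈ C', z k ≠
        C'.card * (t * (F (B ∪ C) - F B)) - C.card * (t * (F (B ∪ C') - F B)) := by
    simp only [ae_all_iff]
    intro B C C' hC hC' hdisj
    rw [ae_iff]
    simpa only [ne_eq, not_not] using volume_hyperplane_eq_zero hC hC' hdisj _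
  filter_upwards [ae_of_ae_map (HasPDF.aemeasurable Z P volume)
    ((HasPDF.absolutelyContinuous (X := Z) (ℙ := P) (μ := volume)).ae_le hgeneric)] with ω hω w hw
  refine exists_isFaceLattice fun A hA => ?_
  rw [blocks_upperSets] at hA
  obtain ⟨hne, α, hα⟩ := hA
  rintro ⟨C, C', hC, hC', hdisj, hunion, hsep⟩
  exact hω _ C C' hC hC' hdisj (mem_hyperplane_of_separable hF hF_empty hF_univ hw hα
    (ancestors_upperSets hne hα) hdisj hunion hsep)
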